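/- Let $n$ be a positive integer and $r\in[1,2]$. Let $\mu_{r,n}$ be the probability measure on $\mathbb{R}^n$ with density $c_{r,n}\exp\{-(|x_1|^r+\dots+|x_n|^r)/r\}$ with respect to Lebesgue measure, where $c_{r,n}>0$ is the normalizing constant. Then for every smooth ($C^\infty$) function $f:\mathbb{R}^n\to\mathbb{R}$ that is square integrable with respect to $\mu_{r,n}$, $$\int f^2\,d\mu_{r,n}-\left(\int f\,d\mu_{r,n}\right)^2\le 4\int\sum_{i=1}^n\frac{|x_i|^{2-r}}{|x_i|^r+2(r-1)}\left(\frac{\partial f}{\partial x_i}(x)\right)^2d\mu_{r,n}(x)\le C_r\int|\nabla f|^2\,d\mu_{r,n},$$ where $C_r=\frac4r(2-r)^{\frac{2-r}{r}}\in(\tfrac95,4]$, with the convention $0^0=1$ (used when $r=2$). The last two integrals may be equal to $+\infty$. -/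

import Mathlib

open MeasureTheory
open scoped ContDiff ENNReal Gradient

/-- The probability measure `μ_{r,n}` on `ℝⁿ` whose density with respect to Lebesgue measure is
`c_{r,n} exp (-(|x₁|^r + ⋯ + |xₙ|^r) / r)`, where `c_{r,n}` normalizes the total mass to `1`. Here
`volume.tilted V` is the measure with density `exp (V x) / ∫ exp V`. -/
noncomputable def muRN (r : ℝ) (n : ℕ) : Measure (EuclideanSpace ℝ (Fin n)) :=
  (volume : Measure (EuclideanSpace ℝ (Fin n))).tilted
    (fun x => -(∑ i, |x i| ^ r) / r)

/-- The partial derivative `∂f/∂x_i` of a function on `ℝⁿ` at `x`. -/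
noncomputable def partialDeriv {n : ℕ} (f : EuclideanSpace ℝ (Fin n) → ℝ) (i : Fin n)
    (x : EuclideanSpace ℝ (Fin n)) : ℝ :=
  fderiv ℝ f x (EuclideanSpace.single i 1)

/-- The constant `C_r = (4 / r) (2 - r) ^ ((2 - r) / r)`. At `r = 2` the last factor is
`0 ^ 0 = 1`, the limit of its values as `r` increases to `2`. -/
noncomputable def constC (r : ℝ) : ℝ :=
  4 / r * (2 - r) ^ ((2 - r) / r)

/-! On the line, let `u` be increasing with mean zero under `μ`. Cauchy–Schwarz gives `(f x - f y)²
≤ (u x - u y) ∫_y^x f'²/u'` for `y ≤ x`. Averaging over independent `x`, `y` and exchanging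
integrals leaves, at each `z`, the mean of `u x - u y` over `y < z ≤ x`, which is `∫_{x ≥ z} u dμ`.
Hence `Var f ≤ ∫ (f'²/u')(z) (∫_{x ≥ z} u dμ) dz` (`evariance_le_lintegral_of_monotone`).

For density proportional to `e^{-V}`, `V = |x|^r / r`, take the odd `u` equal to `V' e^{V/2}` for `x
> 0` (`oddWeight`). Up to normalization the tail integral is `2 e^{-V/2}`, and `u' = (V'' + V'²/2)
e^{V/2}`, so the resulting weight is `4 / (2V'' + V'²)`, exactly the stated one
(`evariance_muR_le`).

Since `muRN` is a product measure, Efron–Stein (`evariance_pi_le`) sums the one-dimensional bounds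
over the coordinates. The comparison with `constC` is pointwise, by concavity of a power. -/

/-! ### Bounds on the weight and on the constant -/

/-- With `t = |x|^r` and `p = (2 - r)/r ∈ [0, 1]`, the numerator is the concave function `t^p`. Its
tangent at `t = 2 - r` is a multiple of the denominator `t + 2(r - 1)`, and the factor gives `constC
r`. -/
theorem four_mul_weight_le_constC {r : ℝ} (hr : r ∈ Set.Icc (1 : ℝ) 2) (x : ℝ) :
    4 * (|x| ^ (2 - r) / (|x| ^ r + 2 * (r - 1))) ≤ constC r := by
  obtain ⟨h1, h2⟩ := hr
  have hr0 : 0 < r := by linarith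
  have hC : 0 ≤ constC r := by
    unfold constC
    have : 0 ≤ 2 - r := by linarith
    positivity
  set y := |x| with hy
  have hy0 : 0 ≤ y := abs_nonneg x
  have ht0 : 0 ≤ y ^ r := by positivity
  have hden : 0 ≤ y ^ r + 2 * (r - 1) := by linarith
  -- The denominator vanishes only for `r = 1`, `x = 0`, where the quotient is `0` by convention.
  rcases hden.eq_or_lt with h0 | hpos
  · rw [← h0, div_zero, mul_zero]; exact hC
  rw [← mul_div_assoc, div_le_iff₀ hpos]
  rcases h2.eq_or_lt with rfl | h2
  · unfold constC
    norm_num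
    nlinarith [sq_nonneg y]
  have hs : 0 < 2 - r := by linarith
  set p := (2 - r) / r with hp
  have hp0 : 0 ≤ p := by positivity
  have hp1 : p ≤ 1 := by rw [hp, div_le_one hr0]; linarith
  have hyt : y ^ (2 - r) = (y ^ r) ^ p := by
    rw [← Real.rpow_mul hy0]; congr 1; rw [hp]; field_simp
  set t := y ^ r with ht
  -- Bernoulli's inequality at `t / (2 - r)` is the tangent line of `t^p` at `2 - r`.
  have hB := rpow_one_add_le_one_add_mul_self (s := t / (2 - r) - 1)
    (by have : 0 ≤ t / (2 - r) := by positivity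
        linarith) hp0 hp1
  rw [add_sub_cancel, Real.div_rpow ht0 hs.le, div_le_iff₀ (by positivity)] at hB
  rw [hyt]
  unfold constC
  rw [← hp]
  calc 4 * t ^ p ≤ 4 * ((1 + p * (t / (2 - r) - 1)) * (2 - r) ^ p) := by linarith
    _ = 4 / r * (2 - r) ^ p * (t + 2 * (r - 1)) := by
      rw [hp]; field_simp; ring

theorem constC_le_four {r : ℝ} (hr : r ∈ Set.Icc (1 : ℝ) 2) : constC r ≤ 4 := by
  obtain ⟨h1, h2⟩ := hr
  have hr0 : 0 < r := by linarith
  have hA : (2 - r) ^ ((2 - r) / r) ≤ 1 :=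
    Real.rpow_le_one (by linarith) (by linarith) (div_nonneg (by linarith) hr0.le)
  have hB : 4 / r ≤ 4 := by rw [div_le_iff₀ hr0]; linarith
  unfold constC
  calc 4 / r * (2 - r) ^ ((2 - r) / r) ≤ 4 / r * 1 := by gcongr
    _ ≤ 4 := by linarith

/-- The supporting line of the convex function `s ↦ s * log s` at `a`. -/
theorem mul_log_add_sub_le_mul_log {s a : ℝ} (hs : 0 ≤ s) (ha : 0 < a) :
    s * Real.log a + s - a ≤ s * Real.log s := by
  rcases hs.eq_or_lt with rfl | hs
  · simp [ha.le]
  have := Real.log_le_sub_one_of_pos (show 0 < a / s by positivity)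
  rw [Real.log_div ha.ne' hs.ne'] at this
  have h2 : s * (Real.log a - Real.log s) ≤ s * (a / s - 1) := by gcongr
  have h3 : s * (a / s - 1) = a - s := by field_simp
  linarith

/-- This is the logarithmic form of `9/5 < constC r`. At `r = 2` the right side is `0`, in agreement
with `0^0 = 1`. -/
theorem mul_log_lt_mul_log_of_mem_Icc {r : ℝ} (hr : r ∈ Set.Icc (1 : ℝ) 2) :
    r * Real.log (9 / 20 * r) < (2 - r) * Real.log (2 - r) := by
  obtain ⟨h1, h2⟩ := hr
  have hr0 : 0 < r := by linarith
  -- The tangent of `log` at `t` bounds the left side above by a quadratic in `r`; the tangent of `s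
  -- log s` at `a` bounds the right side below by an affine function.
  have key : ∀ a t : ℝ, 0 < a → 0 < t →
      r * Real.log (9 / 20 * t) + r * (r / t - 1) < (2 - r) * Real.log a + (2 - r) - a →
      r * Real.log (9 / 20 * r) < (2 - r) * Real.log (2 - r) := by
    intro a t ha ht h
    refine lt_of_le_of_lt ?_ (h.trans_le (mul_log_add_sub_le_mul_log (by linarith) ha))
    have := Real.log_le_sub_one_of_pos (show 0 < r / t by positivity)
    rw [Real.log_div hr0.ne' ht.ne'] at this
    rw [Real.log_mul (by norm_num) hr0.ne', Real.log_mul (by norm_num) ht.ne', ← mul_add]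
    exact mul_le_mul_of_nonneg_left (by linarith) hr0.le
  have hl1 := Real.log_two_gt_d9
  have hl2 := Real.log_two_lt_d9
  rcases le_total r (3 / 2) with h | h
  -- The logarithms are compared with `log 2`: `9/16` is below `2^(-4/5)`, and `177/500` is just
  -- above `2^(-3/2)`.
  · have e1 : 5 * Real.log (9 / 20 * (5 / 4)) ≤ -4 * Real.log 2 := by
      have := Real.log_le_log (by positivity)
        (show (9 / 20 * (5 / 4) : ℝ) ^ 5 ≤ ((2 : ℝ) ^ 4)⁻¹ by norm_num)
      rw [Real.log_inv, Real.log_pow, Real.log_pow] at this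
      push_cast at this
      linarith
    have e2 : -3 * Real.log 2 ≤ 2 * Real.log (177 / 500) := by
      have := Real.log_le_log (by positivity)
        (show ((2 : ℝ) ^ 3)⁻¹ ≤ (177 / 500 : ℝ) ^ 2 by norm_num)
      rw [Real.log_inv, Real.log_pow, Real.log_pow] at this
      push_cast at this
      linarith
    refine key (177 / 500) (5 / 4) (by norm_num) (by norm_num) ?_
    have f1 : r * Real.log (9 / 20 * (5 / 4)) ≤ r * (-0.5545) := by gcongr; linarith
    have f2 : (2 - r) * (-1.04) ≤ (2 - r) * Real.log (177 / 500) :=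
      mul_le_mul_of_nonneg_left (by linarith) (by linarith)
    -- The difference is a convex quadratic in `r`; the hint replaces `r²` by its chord over `[1,
    -- 3/2]`.
    nlinarith [mul_nonneg (sub_nonneg.2 h1) (sub_nonneg.2 h)]
  -- Here `9/20 * 82/45 = 0.82` is just below `2^(-2/7)`, and `177/1000` is just above `2^(-5/2)`.
  · have e1 : 7 * Real.log (9 / 20 * (82 / 45)) ≤ -2 * Real.log 2 := by
      have := Real.log_le_log (by positivity)
        (show (9 / 20 * (82 / 45) : ℝ) ^ 7 ≤ ((2 : ℝ) ^ 2)⁻¹ by norm_num)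
      rw [Real.log_inv, Real.log_pow, Real.log_pow] at this
      push_cast at this
      linarith
    have e2 : -5 * Real.log 2 ≤ 2 * Real.log (177 / 1000) := by
      have := Real.log_le_log (by positivity)
        (show ((2 : ℝ) ^ 5)⁻¹ ≤ (177 / 1000 : ℝ) ^ 2 by norm_num)
      rw [Real.log_inv, Real.log_pow, Real.log_pow] at this
      push_cast at this
      linarith
    refine key (177 / 1000) (82 / 45) (by norm_num) (by norm_num) ?_
    have f1 : r * Real.log (9 / 20 * (82 / 45)) ≤ r * (-0.198) := by gcongr; linarith
    have f2 : (2 - r) * (-1.733) ≤ (2 - r) * Real.log (177 / 1000) :=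
      mul_le_mul_of_nonneg_left (by linarith) (by linarith)
    nlinarith [mul_nonneg (sub_nonneg.2 h) (sub_nonneg.2 h2)]

theorem nine_fifths_lt_constC {r : ℝ} (hr : r ∈ Set.Icc (1 : ℝ) 2) : 9 / 5 < constC r := by
  have hlog := mul_log_lt_mul_log_of_mem_Icc hr
  obtain ⟨h1, h2⟩ := hr
  have hr0 : 0 < r := by linarith
  unfold constC
  rcases h2.eq_or_lt with rfl | h2
  · norm_num
  have hs : 0 < 2 - r := by linarith
  rw [Real.rpow_def_of_pos hs]
  have h3 : Real.log (9 / 20 * r) < Real.log (2 - r) * ((2 - r) / r) := by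
    rw [mul_div_assoc', lt_div_iff₀ hr0]
    linarith
  have h4 := Real.exp_lt_exp.2 h3
  rw [Real.exp_log (by positivity)] at h4
  calc (9 / 5 : ℝ) = 4 / r * (9 / 20 * r) := by field_simp; norm_num
    _ < _ := by gcongr

/-! ### Weighted Poincaré inequality on the line -/

theorem lintegral_mul_sq_le {α : Type*} [MeasurableSpace α] (μ : Measure α) {f g : α → ℝ≥0∞}
    (hf : AEMeasurable f μ) (hg : AEMeasurable g μ) :
    (∫⁻ x, f x * g x ∂μ) ^ 2 ≤ (∫⁻ x, f x ^ 2 ∂μ) * ∫⁻ x, g x ^ 2 ∂μ := by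
  have h := ENNReal.lintegral_mul_le_Lp_mul_Lq μ Real.HolderConjugate.two_two hf hg
  simp only [Pi.mul_apply, ENNReal.rpow_two] at h
  calc (∫⁻ x, f x * g x ∂μ) ^ 2
      ≤ ((∫⁻ x, f x ^ 2 ∂μ) ^ (1 / 2 : ℝ) * (∫⁻ x, g x ^ 2 ∂μ) ^ (1 / 2 : ℝ)) ^ 2 := by gcongr
    _ = _ := by
      rw [mul_pow, ← ENNReal.rpow_two, ← ENNReal.rpow_two, ← ENNReal.rpow_mul, ← ENNReal.rpow_mul]
      norm_num

/-- Only an inequality, since jumps of `u` are invisible to the almost everywhere derivative. This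
generality is needed: `oddWeight 1` jumps at the origin. -/
theorem Monotone.lintegral_deriv_le {u : ℝ → ℝ} (hu : Monotone u) {a b : ℝ} (hab : a ≤ b) :
    ∫⁻ z in Set.Ioc a b, ENNReal.ofReal (deriv u z) ≤ ENNReal.ofReal (u b - u a) := by
  have hm := hu.monotoneOn (Set.uIcc a b)
  have hi := hm.intervalIntegrable_deriv
  have hle := hm.intervalIntegral_deriv_mem_uIcc
  rw [Set.uIcc_of_le (sub_nonneg.2 (hu hab)), intervalIntegral.integral_of_le hab] at hle
  rw [intervalIntegrable_iff_integrableOn_Ioc_of_le hab] at hi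
  rw [← ofReal_integral_eq_lintegral_ofReal hi (ae_of_all _ fun _ => hu.deriv_nonneg)]
  exact ENNReal.ofReal_le_ofReal hle.2

/-- Cauchy–Schwarz for the increment of `f`, weighted by the derivative of a monotone function. -/
theorem ofReal_sq_sub_le_mul_lintegral {u f : ℝ → ℝ} (hu : Monotone u)
    (hpos : ∀ᵐ z, 0 < deriv u z) (hf : ContDiff ℝ 1 f) {a b : ℝ} (hab : a ≤ b) :
    ENNReal.ofReal ((f b - f a) ^ 2) ≤ ENNReal.ofReal (u b - u a) *
      ∫⁻ z in Set.Ioc a b, ENNReal.ofReal (deriv f z ^ 2 / deriv u z) := by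
  have hfm : Measurable (deriv f) := measurable_deriv f
  have hum : Measurable (deriv u) := measurable_deriv u
  have hftc : f b - f a = ∫ z in Set.Ioc a b, deriv f z := by
    rw [← intervalIntegral.integral_of_le hab]
    exact (intervalIntegral.integral_deriv_eq_sub
      (fun x _ => (hf.differentiable one_ne_zero) x)
      ((hf.continuous_deriv le_rfl).intervalIntegrable a b)).symm
  have h1 : ENNReal.ofReal |f b - f a| ≤ ∫⁻ z in Set.Ioc a b,
      ENNReal.ofReal √(deriv u z) * ENNReal.ofReal (|deriv f z| / √(deriv u z)) := by
    rw [hftc, ← Real.norm_eq_abs, ofReal_norm]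
    refine (enorm_integral_le_lintegral_enorm _).trans (le_of_eq ?_)
    refine lintegral_congr_ae (ae_restrict_of_ae ?_)
    filter_upwards [hpos] with z hz
    rw [← ENNReal.ofReal_mul (Real.sqrt_nonneg _), mul_div_cancel₀ _ (Real.sqrt_pos.2 hz).ne',
      ← Real.norm_eq_abs, ofReal_norm]
  calc ENNReal.ofReal ((f b - f a) ^ 2) = ENNReal.ofReal |f b - f a| ^ 2 := by
        rw [← ENNReal.ofReal_pow (abs_nonneg _), sq_abs]
    _ ≤ _ := by gcongr
    _ ≤ _ := lintegral_mul_sq_le _ (by fun_prop) (by fun_prop)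
    _ = (∫⁻ z in Set.Ioc a b, ENNReal.ofReal (deriv u z)) *
        ∫⁻ z in Set.Ioc a b, ENNReal.ofReal (deriv f z ^ 2 / deriv u z) := by
      congr 1
      · refine lintegral_congr fun z => ?_
        rw [← ENNReal.ofReal_pow (Real.sqrt_nonneg _), Real.sq_sqrt hu.deriv_nonneg]
      · refine lintegral_congr fun z => ?_
        have : 0 ≤ |deriv f z| / √(deriv u z) := by positivity
        rw [← ENNReal.ofReal_pow this, div_pow, Real.sq_sqrt hu.deriv_nonneg, sq_abs]
    _ ≤ _ := by gcongr; exact hu.lintegral_deriv_le hab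

/-- The variance is at most half the mean square of `f x - f y` for independent `x` and `y`. -/
theorem two_mul_evariance_le {α : Type*} [MeasurableSpace α] (μ : Measure α)
    [IsProbabilityMeasure μ] {f : α → ℝ} (hf : Measurable f) :
    2 * ProbabilityTheory.evariance f μ ≤
      ∫⁻ x, ∫⁻ y, ENNReal.ofReal ((f x - f y) ^ 2) ∂μ ∂μ := by
  by_cases hL : MemLp f 2 μ
  · have hi := hL.integrable one_le_two
    have hi2 := hL.integrable_sq
    have hpt : ∀ x, ∫⁻ y, ENNReal.ofReal ((f x - f y) ^ 2) ∂μ =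
        ENNReal.ofReal (f x ^ 2 - 2 * f x * ∫ y, f y ∂μ + ∫ y, f y ^ 2 ∂μ) := by
      intro x
      have hsub : Integrable (fun y => f x ^ 2 - 2 * f x * f y) μ :=
        (integrable_const _).sub (hi.const_mul _)
      have hint : Integrable (fun y => f x ^ 2 - 2 * f x * f y + f y ^ 2) μ := hsub.add hi2
      rw [show (fun y => ENNReal.ofReal ((f x - f y) ^ 2)) =
          fun y => ENNReal.ofReal (f x ^ 2 - 2 * f x * f y + f y ^ 2) by
        funext y; congr 1; ring]
      rw [← ofReal_integral_eq_lintegral_ofReal hint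
        (ae_of_all _ fun y => by
          have := sq_nonneg (f x - f y)
          simp only [Pi.zero_apply]
          nlinarith)]
      congr 1
      rw [integral_add hsub hi2,
        integral_sub (integrable_const _) (hi.const_mul _), integral_const_mul]
      simp
    simp_rw [hpt]
    rw [← ProbabilityTheory.ofReal_variance hL, ProbabilityTheory.variance_eq_sub hL]
    have hnn : ∀ x, 0 ≤ f x ^ 2 - 2 * f x * ∫ y, f y ∂μ + ∫ y, f y ^ 2 ∂μ := by
      intro x
      have := ProbabilityTheory.variance_nonneg f μ
      rw [ProbabilityTheory.variance_eq_sub hL] at this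
      simp only [Pi.pow_apply] at this
      nlinarith [sq_nonneg (f x - ∫ y, f y ∂μ)]
    have hI : Integrable (fun x => 2 * f x * ∫ y, f y ∂μ) μ := (hi.const_mul 2).mul_const _
    have hsub : Integrable (fun x => f x ^ 2 - 2 * f x * ∫ y, f y ∂μ) μ := hi2.sub hI
    have hint : Integrable
        (fun x => f x ^ 2 - 2 * f x * ∫ y, f y ∂μ + ∫ y, f y ^ 2 ∂μ) μ :=
      hsub.add (integrable_const _)
    rw [← ofReal_integral_eq_lintegral_ofReal hint (ae_of_all _ hnn),
      show (2 : ℝ≥0∞) = ENNReal.ofReal 2 by norm_num,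
      ← ENNReal.ofReal_mul (by norm_num)]
    apply le_of_eq
    congr 1
    rw [integral_add hsub (integrable_const _), integral_sub hi2 hI,
      integral_mul_const, integral_const_mul]
    simp only [integral_const, probReal_univ, smul_eq_mul, Pi.pow_apply]
    ring
  -- Were the double integral finite, `f x - f` would be square integrable for some fixed `x`, hence
  -- so would `f`.
  · suffices h : ∫⁻ x, ∫⁻ y, ENNReal.ofReal ((f x - f y) ^ 2) ∂μ ∂μ = ⊤ by rw [h]; exact le_top
    by_contra hne
    have hm : Measurable fun x => ∫⁻ y, ENNReal.ofReal ((f x - f y) ^ 2) ∂μ :=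
      Measurable.lintegral_prod_right' (f := fun p : α × α => ENNReal.ofReal ((f p.1 - f p.2) ^ 2))
        (by fun_prop)
    obtain ⟨x, hx⟩ := (ae_lt_top hm hne).exists
    have h2 : MemLp (fun y => f x - f y) 2 μ := by
      rw [memLp_two_iff_integrable_sq (by fun_prop)]
      refine ⟨by fun_prop, ?_⟩
      rw [hasFiniteIntegral_iff_ofReal (ae_of_all _ fun y => sq_nonneg _)]
      exact hx
    refine hL ?_
    have := (memLp_const (f x)).sub h2
    convert this using 1
    funext y
    simp

/-- Mean zero makes the integrals of `u` over the two half-lines opposite, and the masses of the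
half-lines, which multiply them, add up to `1`. -/
theorem lintegral_Ici_lintegral_Iio_ofReal_sub {μ : Measure ℝ} [IsProbabilityMeasure μ] {u : ℝ → ℝ}
    (hu : Monotone u) (hi : Integrable u μ) (h0 : ∫ x, u x ∂μ = 0) (z : ℝ) :
    ∫⁻ x in Set.Ici z, ∫⁻ y in Set.Iio z, ENNReal.ofReal (u x - u y) ∂μ ∂μ =
      ENNReal.ofReal (∫ x in Set.Ici z, u x ∂μ) := by
  have hiy : IntegrableOn u (Set.Iio z) μ := hi.integrableOn
  have hix : IntegrableOn u (Set.Ici z) μ := hi.integrableOn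
  have hc : ∀ x, ∫ y in Set.Iio z, (u x - u y) ∂μ =
      μ.real (Set.Iio z) * u x - ∫ y in Set.Iio z, u y ∂μ := by
    intro x
    rw [integral_sub (integrable_const _) hiy]
    simp
  have h1 : ∀ x ∈ Set.Ici z, ∫⁻ y in Set.Iio z, ENNReal.ofReal (u x - u y) ∂μ =
      ENNReal.ofReal (μ.real (Set.Iio z) * u x - ∫ y in Set.Iio z, u y ∂μ) := by
    intro x hx
    have hint : IntegrableOn (fun y => u x - u y) (Set.Iio z) μ := (integrable_const _).sub hiy
    rw [← hc, ofReal_integral_eq_lintegral_ofReal hint]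
    filter_upwards [ae_restrict_mem measurableSet_Iio] with y hy
    exact sub_nonneg.2 (hu (le_of_lt (lt_of_lt_of_le hy hx)))
  have hint : IntegrableOn (fun x => μ.real (Set.Iio z) * u x - ∫ y in Set.Iio z, u y ∂μ)
      (Set.Ici z) μ := (hix.const_mul _).sub (integrable_const _)
  rw [setLIntegral_congr_fun measurableSet_Ici h1, ← ofReal_integral_eq_lintegral_ofReal hint]
  · congr 1
    rw [integral_sub (hix.const_mul _) (integrable_const _), integral_const_mul]
    have hs := integral_add_compl (measurableSet_Ici (a := z)) hi
    have hp := probReal_add_probReal_compl (μ := μ) (measurableSet_Ici (a := z))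
    rw [Set.compl_Ici] at hs hp
    simp only [integral_const, measureReal_restrict_apply MeasurableSet.univ, Set.univ_inter,
      smul_eq_mul]
    rw [h0] at hs
    rw [show ∫ y in Set.Iio z, u y ∂μ = - ∫ x in Set.Ici z, u x ∂μ by linarith]
    linear_combination (∫ x in Set.Ici z, u x ∂μ) * hp
  · filter_upwards [ae_restrict_mem measurableSet_Ici] with x hx
    rw [Pi.zero_apply, ← hc]
    refine setIntegral_nonneg measurableSet_Iio fun y hy => ?_
    exact sub_nonneg.2 (hu (le_of_lt (lt_of_lt_of_le hy hx)))

/-- A weighted Poincaré inequality on the line, whose weight is given by a monotone function `u`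
of zero mean. -/
theorem evariance_le_lintegral_of_monotone {μ : Measure ℝ} [IsProbabilityMeasure μ] {u f : ℝ → ℝ}
    (hu : Monotone u) (hi : Integrable u μ) (h0 : ∫ x, u x ∂μ = 0)
    (hpos : ∀ᵐ z, 0 < deriv u z) (hf : ContDiff ℝ 1 f) :
    ProbabilityTheory.evariance f μ ≤ ∫⁻ z, ENNReal.ofReal (deriv f z ^ 2 / deriv u z) *
      ENNReal.ofReal (∫ x in Set.Ici z, u x ∂μ) := by
  have hfm : Measurable (deriv f) := measurable_deriv f
  have hum : Measurable (deriv u) := measurable_deriv u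
  have humeas : Measurable u := hu.measurable
  set G : ℝ → ℝ≥0∞ := fun z => ENNReal.ofReal (deriv f z ^ 2 / deriv u z) with hG
  have hGm : Measurable G := by fun_prop
  -- The Cauchy–Schwarz bound as one integrand supported on `y < z ≤ x`, ready for Tonelli.
  set Φ : ℝ → ℝ → ℝ → ℝ≥0∞ := fun x y z =>
    (Set.Ici z).indicator (fun x => (Set.Iio z).indicator
      (fun y => G z * ENNReal.ofReal (u x - u y)) y) x with hΦ
  have hΦm : Measurable fun p : ℝ × ℝ × ℝ => Φ p.1 p.2.1 p.2.2 := by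
    have : (fun p : ℝ × ℝ × ℝ => Φ p.1 p.2.1 p.2.2) =
        {p : ℝ × ℝ × ℝ | p.2.2 ≤ p.1 ∧ p.2.1 < p.2.2}.indicator
          (fun p => G p.2.2 * ENNReal.ofReal (u p.1 - u p.2.1)) := by
      funext p
      simp only [hΦ, Set.indicator_apply, Set.mem_Ici, Set.mem_Iio, Set.mem_ofPred_eq]
      split_ifs <;> simp_all
    rw [this]
    refine Measurable.indicator (by fun_prop) ?_
    exact (measurableSet_le (f := fun p : ℝ × ℝ × ℝ => p.2.2) (g := fun p => p.1)
      (by fun_prop) (by fun_prop)).inter (measurableSet_lt (f := fun p : ℝ × ℝ × ℝ => p.2.1)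
      (g := fun p => p.2.2) (by fun_prop) (by fun_prop))
  have hpt : ∀ x y, y ≤ x → ENNReal.ofReal ((f x - f y) ^ 2) ≤ ∫⁻ z, Φ x y z := by
    intro x y hxy
    refine (ofReal_sq_sub_le_mul_lintegral hu hpos hf hxy).trans (le_of_eq ?_)
    rw [← lintegral_const_mul _ hGm, ← lintegral_indicator measurableSet_Ioc]
    refine lintegral_congr fun z => ?_
    simp only [hΦ, Set.indicator_apply, Set.mem_Ici, Set.mem_Iio, Set.mem_Ioc]
    split_ifs <;> simp_all [mul_comm]
  have hpt' : ∀ x y, ENNReal.ofReal ((f x - f y) ^ 2) ≤ (∫⁻ z, Φ x y z) + ∫⁻ z, Φ y x z := by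
    intro x y
    rcases le_total y x with h | h
    · exact (hpt x y h).trans le_self_add
    · rw [← neg_sq, neg_sub]
      exact (hpt y x h).trans le_add_self
  have hΨm : Measurable fun p : ℝ × ℝ => ∫⁻ z, Φ p.1 p.2 z :=
    Measurable.lintegral_prod_right' (f := fun q : (ℝ × ℝ) × ℝ => Φ q.1.1 q.1.2 q.2)
      (hΦm.comp (by fun_prop : Measurable fun q : (ℝ × ℝ) × ℝ => (q.1.1, q.1.2, q.2)))
  -- The two orderings of `x` and `y` contribute equally, which cancels the factor `2`.
  have hsum : 2 * ProbabilityTheory.evariance f μ ≤ 2 * ∫⁻ x, ∫⁻ y, (∫⁻ z, Φ x y z) ∂μ ∂μ := by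
    refine (two_mul_evariance_le μ hf.continuous.measurable).trans ?_
    calc _ ≤ ∫⁻ x, ∫⁻ y, ((∫⁻ z, Φ x y z) + ∫⁻ z, Φ y x z) ∂μ ∂μ := by
          gcongr with x y; exact hpt' x y
      _ = (∫⁻ x, ∫⁻ y, (∫⁻ z, Φ x y z) ∂μ ∂μ) + ∫⁻ x, ∫⁻ y, (∫⁻ z, Φ y x z) ∂μ ∂μ := by
          rw [← lintegral_add_left (Measurable.lintegral_prod_right' hΨm)]
          refine lintegral_congr fun x => ?_
          rw [lintegral_add_left]
          exact hΨm.comp (by fun_prop : Measurable fun y : ℝ => (x, y))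
      _ = _ := by
          rw [lintegral_lintegral_swap (f := fun x y => ∫⁻ z, Φ y x z), two_mul]
          exact (hΨm.comp measurable_swap).aemeasurable
  have h2 := (ENNReal.mul_le_mul_iff_right two_ne_zero ENNReal.ofNat_ne_top).1 hsum
  refine h2.trans (le_of_eq ?_)
  calc ∫⁻ x, ∫⁻ y, (∫⁻ z, Φ x y z) ∂μ ∂μ = ∫⁻ x, (∫⁻ z, ∫⁻ y, Φ x y z ∂μ) ∂μ := by
        refine lintegral_congr fun x => lintegral_lintegral_swap (f := fun y z => Φ x y z) ?_
        exact (hΦm.comp (by fun_prop : Measurable fun q : ℝ × ℝ => (x, q.1, q.2))).aemeasurable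
    _ = ∫⁻ z, ∫⁻ x, ∫⁻ y, Φ x y z ∂μ ∂μ := by
        refine lintegral_lintegral_swap (f := fun x z => ∫⁻ y, Φ x y z ∂μ) ?_
        refine Measurable.aemeasurable ?_
        exact Measurable.lintegral_prod_right' (f := fun q : (ℝ × ℝ) × ℝ => Φ q.1.1 q.2 q.1.2)
          (hΦm.comp (by fun_prop : Measurable fun q : (ℝ × ℝ) × ℝ => (q.1.1, q.2, q.1.2)))
    _ = _ := by
        refine lintegral_congr fun z => ?_
        rw [← lintegral_Ici_lintegral_Iio_ofReal_sub hu hi h0 z]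
        have e : ∀ x, ∫⁻ y, Φ x y z ∂μ = (Set.Ici z).indicator (fun x =>
            G z * ∫⁻ y in Set.Iio z, ENNReal.ofReal (u x - u y) ∂μ) x := by
          intro x
          by_cases hx : x ∈ Set.Ici z
          · simp only [hΦ, Set.indicator_of_mem hx]
            rw [lintegral_indicator measurableSet_Iio, lintegral_const_mul _ (by fun_prop)]
          · simp [hΦ, Set.indicator_of_notMem hx]
        simp_rw [e]
        rw [lintegral_indicator measurableSet_Ici, lintegral_const_mul]
        exact Measurable.lintegral_prod_right'
          (f := fun p : ℝ × ℝ => ENNReal.ofReal (u p.1 - u p.2)) (by fun_prop)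

/-! ### The one-dimensional measure and its odd weight -/

theorem integrable_comp_abs {g : ℝ → ℝ} (hg : IntegrableOn g (Set.Ioi 0)) :
    Integrable fun x => g |x| := by
  have h1 : IntegrableOn (fun x => g |x|) (Set.Ioi 0) :=
    hg.congr_fun (fun x hx => by simp only [abs_of_pos (Set.mem_Ioi.1 hx)]) measurableSet_Ioi
  have h2 : IntegrableOn (fun x => g |x|) (Set.Iio 0) := by
    have := (Measure.measurePreserving_neg (volume : Measure ℝ)).integrableOn_comp_preimage
      (Homeomorph.neg ℝ).measurableEmbedding (f := fun x => g |x|) (s := Set.Ioi 0)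
    have h := this.2 h1
    simpa [Function.comp_def] using h
  rw [← integrableOn_univ, ← Set.Iic_union_Ioi (a := (0 : ℝ)), integrableOn_union,
    integrableOn_Iic_iff_integrableOn_Iio]
  exact ⟨h2, h1⟩

theorem integrable_abs_rpow_mul_exp {s r b : ℝ} (hs : -1 < s) (hr : 0 < r) (hb : 0 < b) :
    Integrable fun x : ℝ => |x| ^ s * Real.exp (-b * |x| ^ r) :=
  integrable_comp_abs (integrableOn_rpow_mul_exp_neg_mul_rpow hs hr hb)

theorem integrable_exp_neg_abs_rpow_div {r : ℝ} (hr : 0 < r) :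
    Integrable fun x : ℝ => Real.exp (-|x| ^ r / r) := by
  have := integrable_abs_rpow_mul_exp (s := 0) (b := r⁻¹) (by norm_num) hr (by positivity)
  refine this.congr (ae_of_all _ fun x => ?_)
  simp only [Real.rpow_zero, one_mul]
  congr 1
  field_simp

/-- The probability measure on `ℝ` with density proportional to `exp (-|x| ^ r / r)`. -/
noncomputable def muR (r : ℝ) : Measure ℝ := volume.tilted fun x => -|x| ^ r / r

theorem isProbabilityMeasure_muR {r : ℝ} (hr : 0 < r) : IsProbabilityMeasure (muR r) :=
  isProbabilityMeasure_tilted (integrable_exp_neg_abs_rpow_div hr)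

/-- The odd function `sign x * V' |x| * exp (V x / 2)` for the potential `V x = |x| ^ r / r`. -/
noncomputable def oddWeight (r x : ℝ) : ℝ :=
  Real.sign x * (|x| ^ (r - 1) * Real.exp (|x| ^ r / (2 * r)))

theorem oddWeight_neg (r x : ℝ) : oddWeight r (-x) = -oddWeight r x := by
  simp [oddWeight, Real.sign_neg]

theorem oddWeight_of_pos (r : ℝ) {x : ℝ} (hx : 0 < x) :
    oddWeight r x = x ^ (r - 1) * Real.exp (x ^ r / (2 * r)) := by
  simp [oddWeight, Real.sign_of_pos hx, abs_of_pos hx]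

theorem monotone_oddWeight {r : ℝ} (hr : 1 ≤ r) : Monotone (oddWeight r) := by
  have hr0 : 0 < r := by linarith
  have hnn : ∀ x, 0 ≤ x → 0 ≤ oddWeight r x := by
    intro x hx
    rcases hx.eq_or_lt with rfl | hx
    · simp [oddWeight]
    · rw [oddWeight_of_pos r hx]; positivity
  have hmono : ∀ x y, 0 ≤ x → x ≤ y → oddWeight r x ≤ oddWeight r y := by
    intro x y hx hxy
    rcases hx.eq_or_lt with rfl | hx
    · have := hnn y hxy
      simpa [oddWeight] using this
    · rw [oddWeight_of_pos r hx, oddWeight_of_pos r (hx.trans_le hxy)]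
      have hy : 0 < y := hx.trans_le hxy
      gcongr
  intro x y hxy
  rcases le_total 0 x with hx | hx
  · exact hmono x y hx hxy
  rcases le_total 0 y with hy | hy
  · have h1 := hnn (-x) (by linarith)
    rw [oddWeight_neg] at h1
    linarith [hnn y hy]
  · have := hmono (-y) (-x) (by linarith) (by linarith)
    rw [oddWeight_neg, oddWeight_neg] at this
    linarith

/-- This is `(V'' + V'²/2) e^{V/2}` with `V' = x^(r - 1)`. -/
theorem hasDerivAt_oddWeight_of_pos {r x : ℝ} (hr : 0 < r) (hx : 0 < x) :
    HasDerivAt (oddWeight r)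
      ((2 * (r - 1) + |x| ^ r) * |x| ^ (r - 2) / 2 * Real.exp (|x| ^ r / (2 * r))) x := by
  have h1 : HasDerivAt (fun x : ℝ => x ^ (r - 1)) ((r - 1) * x ^ (r - 1 - 1)) x :=
    Real.hasDerivAt_rpow_const (Or.inl hx.ne')
  have h2 : HasDerivAt (fun x : ℝ => x ^ r / (2 * r)) (r * x ^ (r - 1) / (2 * r)) x :=
    (Real.hasDerivAt_rpow_const (Or.inl hx.ne')).div_const _
  have h3 := h1.mul h2.exp
  refine (h3.congr_of_eventuallyEq ?_).congr_deriv ?_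
  · filter_upwards [lt_mem_nhds hx] with y hy
    simp [oddWeight_of_pos r hy]
  · rw [abs_of_pos hx]
    have e1 : x ^ (r - 1) = x ^ (r - 2) * x := by
      rw [← Real.rpow_add_one hx.ne']; ring_nf
    have e2 : x ^ r = x ^ (r - 2) * x * x := by
      rw [← Real.rpow_add_one hx.ne', ← Real.rpow_add_one hx.ne']; ring_nf
    rw [show r - 1 - 1 = r - 2 by ring, e1, e2]
    field_simp

theorem deriv_oddWeight {r x : ℝ} (hr : 0 < r) (hx : x ≠ 0) :
    deriv (oddWeight r) x =
      (2 * (r - 1) + |x| ^ r) * |x| ^ (r - 2) / 2 * Real.exp (|x| ^ r / (2 * r)) := by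
  rcases hx.lt_or_gt with hx | hx
  · have h : oddWeight r = fun y => -oddWeight r (-y) := by
      funext y; rw [oddWeight_neg, neg_neg]
    rw [h, deriv.fun_neg, deriv_comp_neg,
      (hasDerivAt_oddWeight_of_pos hr (neg_pos.2 hx)).deriv, neg_neg, abs_neg]
  · exact (hasDerivAt_oddWeight_of_pos hr hx).deriv

/-- The density cancels half of the exponent: for `x > 0` what remains is `V' e^{-V/2}`, the
derivative of `-2 e^{-V/2}`. -/
theorem exp_mul_oddWeight {r : ℝ} (hr : 0 < r) (x : ℝ) :
    Real.exp (-|x| ^ r / r) * oddWeight r x =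
      Real.sign x * (|x| ^ (r - 1) * Real.exp (-(2 * r)⁻¹ * |x| ^ r)) := by
  have : Real.exp (-(2 * r)⁻¹ * |x| ^ r) =
      Real.exp (-|x| ^ r / r) * Real.exp (|x| ^ r / (2 * r)) := by
    rw [← Real.exp_add]; congr 1; field_simp; ring
  rw [oddWeight, this]
  ring

theorem measurable_sign : Measurable Real.sign := by
  unfold Real.sign
  exact Measurable.ite measurableSet_Iio measurable_const
    (Measurable.ite measurableSet_Ioi measurable_const measurable_const)

theorem integrable_exp_mul_oddWeight {r : ℝ} (hr : 1 ≤ r) :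
    Integrable fun x => Real.exp (-|x| ^ r / r) * oddWeight r x := by
  have hr0 : 0 < r := by linarith
  simp_rw [exp_mul_oddWeight hr0]
  refine (integrable_abs_rpow_mul_exp (s := r - 1) (by linarith) hr0
    (by positivity : 0 < (2 * r)⁻¹)).bdd_mul (c := 1) measurable_sign.aestronglyMeasurable ?_
  refine ae_of_all _ fun x => ?_
  rcases Real.sign_apply_eq x with h | h | h <;> simp [h]

theorem setIntegral_Ioi_exp_mul_oddWeight {r : ℝ} (hr : 1 ≤ r) {z : ℝ} (hz : 0 ≤ z) :
    ∫ x in Set.Ioi z, Real.exp (-|x| ^ r / r) * oddWeight r x =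
      2 * Real.exp (-(2 * r)⁻¹ * z ^ r) := by
  have hr0 : 0 < r := by linarith
  have h := integral_Ioi_of_hasDerivAt_of_tendsto (a := z) (m := 0)
    (f := fun x => -2 * Real.exp (-(2 * r)⁻¹ * x ^ r))
    (f' := fun x => Real.exp (-|x| ^ r / r) * oddWeight r x) ?_ ?_
    (integrable_exp_mul_oddWeight hr).integrableOn ?_
  · rw [h]; ring
  · have : Continuous fun x : ℝ => x ^ r := Real.continuous_rpow_const hr0.le
    fun_prop
  · intro x hx
    have hx0 : 0 < x := hz.trans_lt hx
    have h2 : HasDerivAt (fun x : ℝ => -(2 * r)⁻¹ * x ^ r) (-(2 * r)⁻¹ * (r * x ^ (r - 1))) x :=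
      (Real.hasDerivAt_rpow_const (Or.inl hx0.ne')).const_mul _
    refine (h2.exp.const_mul (-2)).congr_deriv ?_
    rw [exp_mul_oddWeight hr0, Real.sign_of_pos hx0, abs_of_pos hx0]
    field_simp
  · have h1 : Filter.Tendsto (fun x : ℝ => -(2 * r)⁻¹ * x ^ r) Filter.atTop Filter.atBot :=
      (tendsto_rpow_atTop hr0).const_mul_atTop_of_neg (by rw [neg_lt_zero]; positivity)
    simpa using (Real.tendsto_exp_atBot.comp h1).const_mul (-2)

theorem integral_exp_mul_oddWeight (r : ℝ) :
    ∫ x, Real.exp (-|x| ^ r / r) * oddWeight r x = 0 := by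
  have h := integral_neg_eq_self (fun x => Real.exp (-|x| ^ r / r) * oddWeight r x) volume
  simp only [abs_neg, oddWeight_neg, mul_neg, integral_neg] at h
  linarith

theorem setIntegral_Ici_exp_mul_oddWeight {r : ℝ} (hr : 1 ≤ r) (z : ℝ) :
    ∫ x in Set.Ici z, Real.exp (-|x| ^ r / r) * oddWeight r x =
      2 * Real.exp (-(2 * r)⁻¹ * |z| ^ r) := by
  rcases le_total 0 z with hz | hz
  · rw [integral_Ici_eq_integral_Ioi, setIntegral_Ioi_exp_mul_oddWeight hr hz, abs_of_nonneg hz]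
  -- For `z ≤ 0`, vanishing of the total integral and oddness turn the tail from `z` into the tail
  -- from `-z`.
  · have hs := integral_add_compl (measurableSet_Ici (a := z)) (integrable_exp_mul_oddWeight hr)
    rw [integral_exp_mul_oddWeight, Set.compl_Ici] at hs
    have hn := integral_comp_neg_Iic z (fun x => Real.exp (-|x| ^ r / r) * oddWeight r x)
    rw [setIntegral_Ioi_exp_mul_oddWeight hr (neg_nonneg.2 hz)] at hn
    simp only [abs_neg, oddWeight_neg, mul_neg, integral_neg] at hn
    rw [integral_Iic_eq_integral_Iio] at hn
    rw [abs_of_nonpos hz]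
    linarith

theorem integrable_oddWeight {r : ℝ} (hr : 1 ≤ r) : Integrable (oddWeight r) (muR r) := by
  have hm : Measurable fun x : ℝ => Real.exp (-|x| ^ r / r) / ∫ x : ℝ, Real.exp (-|x| ^ r / r) := by
    fun_prop
  rw [muR, Measure.tilted, integrable_withDensity_iff_integrable_smul' hm.ennreal_ofReal
    (ae_of_all _ fun _ => ENNReal.ofReal_lt_top)]
  refine ((integrable_exp_mul_oddWeight hr).div_const
    (∫ x : ℝ, Real.exp (-|x| ^ r / r))).congr (ae_of_all _ fun x => ?_)
  simp only [smul_eq_mul]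
  rw [ENNReal.toReal_ofReal (by positivity)]
  ring

/-- The weighted Poincaré inequality for `muR r`. -/
theorem evariance_muR_le {r : ℝ} (hr : 1 ≤ r) {f : ℝ → ℝ} (hf : ContDiff ℝ 1 f) :
    ProbabilityTheory.evariance f (muR r) ≤ ∫⁻ z, ENNReal.ofReal
      (4 * (|z| ^ (2 - r) / (|z| ^ r + 2 * (r - 1)) * deriv f z ^ 2)) ∂muR r := by
  have hr0 : 0 < r := by linarith
  have := isProbabilityMeasure_muR hr0
  have hZ : 0 < ∫ x : ℝ, Real.exp (-|x| ^ r / r) :=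
    integral_exp_pos (integrable_exp_neg_abs_rpow_div hr0)
  have hne : ∀ᵐ z : ℝ, z ≠ 0 := by simp [ae_iff]
  have hpos : ∀ᵐ z, 0 < deriv (oddWeight r) z := by
    filter_upwards [hne] with z hz
    rw [deriv_oddWeight hr0 hz]
    have : 0 < |z| := abs_pos.2 hz
    have : 0 ≤ r - 1 := by linarith
    positivity
  have h0 : ∫ x, oddWeight r x ∂muR r = 0 := by
    rw [muR, integral_tilted]
    simp_rw [smul_eq_mul, div_mul_eq_mul_div]
    rw [integral_div, integral_exp_mul_oddWeight, zero_div]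
  refine (evariance_le_lintegral_of_monotone (monotone_oddWeight hr) (integrable_oddWeight hr) h0
    hpos hf).trans (le_of_eq ?_)
  rw [muR, lintegral_tilted]
  refine lintegral_congr_ae ?_
  filter_upwards [hne] with z hz
  rw [setIntegral_tilted _ _ _]
  simp_rw [smul_eq_mul, div_mul_eq_mul_div]
  rw [integral_div, setIntegral_Ici_exp_mul_oddWeight hr, deriv_oddWeight hr0 hz]
  have hz' : 0 < |z| := abs_pos.2 hz
  have : 0 ≤ r - 1 := by linarith
  rw [← ENNReal.ofReal_mul (by positivity), ← ENNReal.ofReal_mul (by positivity)]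
  congr 1
  -- The tail `e^{-V/2}` over the `e^{V/2}` in the derivative restores the density `e^{-V}`.
  have e1 : Real.exp (-|z| ^ r / r) =
      Real.exp (-(2 * r)⁻¹ * |z| ^ r) / Real.exp (|z| ^ r / (2 * r)) := by
    rw [← Real.exp_sub]; congr 1; field_simp; ring
  have e2 : |z| ^ (r - 2) = (|z| ^ (2 - r))⁻¹ := by
    rw [← Real.rpow_neg hz'.le]; ring_nf
  rw [e1, e2]
  field_simp
  ring

/-! ### Tensorization of the variance -/

open ProbabilityTheory in
theorem lintegral_ofReal_sq_sub_const {β : Type*} [MeasurableSpace β] {ν : Measure β}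
    [IsProbabilityMeasure ν] {X : β → ℝ} (hX : MemLp X 2 ν) (c : ℝ) :
    ∫⁻ b, ENNReal.ofReal ((X b - c) ^ 2) ∂ν =
      evariance X ν + ENNReal.ofReal ((∫ b, X b ∂ν - c) ^ 2) := by
  have hi := hX.integrable one_le_two
  have hi2 : Integrable (fun b => X b ^ 2) ν := hX.integrable_sq
  have hic : Integrable (fun b => 2 * c * X b) ν := hi.const_mul _
  have hs : Integrable (fun b => X b ^ 2 - 2 * c * X b) ν := hi2.sub hic
  have ha : Integrable (fun b => X b ^ 2 - 2 * c * X b + c ^ 2) ν := hs.add (integrable_const _)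
  have he : (fun b => (X b - c) ^ 2) = fun b => X b ^ 2 - 2 * c * X b + c ^ 2 := by
    funext b; ring
  rw [← ofReal_integral_eq_lintegral_ofReal (by rw [he]; exact ha)
    (ae_of_all _ fun b => sq_nonneg _), ← ofReal_variance hX,
    ← ENNReal.ofReal_add (variance_nonneg _ _) (sq_nonneg _), variance_eq_sub hX, he,
    integral_add hs (integrable_const _), integral_sub hi2 hic, integral_const_mul]
  congr 1
  simp only [integral_const, probReal_univ, smul_eq_mul, Pi.pow_apply]
  ring

theorem ofReal_sq_integral_le {β : Type*} [MeasurableSpace β] {ν : Measure β}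
    [IsProbabilityMeasure ν] {Y : β → ℝ} (hY : Integrable Y ν) :
    ENNReal.ofReal ((∫ b, Y b ∂ν) ^ 2) ≤ ∫⁻ b, ENNReal.ofReal (Y b ^ 2) ∂ν := by
  have hsq : ∀ t : ℝ, ENNReal.ofReal (t ^ 2) = ‖t‖ₑ ^ 2 := fun t => by
    rw [← ofReal_norm, ← ENNReal.ofReal_pow (norm_nonneg _), Real.norm_eq_abs, sq_abs]
  simp_rw [hsq]
  calc ‖∫ b, Y b ∂ν‖ₑ ^ 2 ≤ (∫⁻ b, ‖Y b‖ₑ * 1 ∂ν) ^ 2 := by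
        simp_rw [mul_one]
        gcongr
        exact enorm_integral_le_lintegral_enorm _
    _ ≤ (∫⁻ b, ‖Y b‖ₑ ^ 2 ∂ν) * ∫⁻ _, 1 ^ 2 ∂ν :=
        lintegral_mul_sq_le ν hY.1.enorm aemeasurable_const
    _ = _ := by simp

open ProbabilityTheory in
theorem measurable_evariance_right {α β : Type*} [MeasurableSpace α] [MeasurableSpace β]
    {ν : Measure β} [SFinite ν] {G : α × β → ℝ} (hG : Measurable G) :
    Measurable fun a => evariance (fun b => G (a, b)) ν := by
  simp_rw [evariance_eq_lintegral_ofReal]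
  have h : Measurable fun a => ∫ b, G (a, b) ∂ν :=
    (hG.stronglyMeasurable.integral_prod_right' (ν := ν)).measurable
  exact Measurable.lintegral_prod_right'
    (f := fun p : α × β => ENNReal.ofReal ((G p - ∫ b, G (p.1, b) ∂ν) ^ 2))
    ((hG.sub (h.comp measurable_fst)).pow_const 2).ennreal_ofReal

theorem ae_memLp_two_prodMk {α β : Type*} [MeasurableSpace α] [MeasurableSpace β]
    {μ : Measure α} {ν : Measure β} [SFinite μ] [SFinite ν] {f : α × β → ℝ}
    (hfm : Measurable f) (hf : MemLp f 2 (μ.prod ν)) :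
    ∀ᵐ a ∂μ, MemLp (fun b => f (a, b)) 2 ν := by
  filter_upwards [hf.integrable_sq.prod_right_ae] with a ha
  exact (memLp_two_iff_integrable_sq
    (hfm.comp measurable_prodMk_left).aestronglyMeasurable).2 ha

open ProbabilityTheory in
/-- The Efron–Stein inequality for a product of two probability spaces. -/
theorem evariance_prod_le {α β : Type*} [MeasurableSpace α] [MeasurableSpace β]
    (μ : Measure α) (ν : Measure β) [IsProbabilityMeasure μ] [IsProbabilityMeasure ν]
    {f : α × β → ℝ} (hfm : Measurable f) (hf : MemLp f 2 (μ.prod ν)) :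
    evariance f (μ.prod ν) ≤ ∫⁻ a, evariance (fun b => f (a, b)) ν ∂μ +
      ∫⁻ b, evariance (fun a => f (a, b)) μ ∂ν := by
  have hi : Integrable f (μ.prod ν) := hf.integrable one_le_two
  have hm : ∫ p, f p ∂μ.prod ν = ∫ b, ∫ a, f (a, b) ∂μ ∂ν := integral_prod_symm f hi
  have hh : Integrable (fun b => ∫ a, f (a, b) ∂μ) ν := hi.integral_prod_right
  have hhm : Measurable fun b => ∫ a, f (a, b) ∂μ :=
    (hfm.stronglyMeasurable.integral_prod_left' (μ := μ)).measurable
  rw [evariance_eq_lintegral_ofReal, lintegral_prod _ (by fun_prop)]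
  simp_rw [evariance_eq_lintegral_ofReal (fun a => f (a, _))]
  rw [← lintegral_lintegral_swap
      (f := fun a b => ENNReal.ofReal ((f (a, b) - ∫ a, f (a, b) ∂μ) ^ 2))
      ((hfm.sub (hhm.comp measurable_snd)).pow_const 2).ennreal_ofReal.aemeasurable,
    ← lintegral_add_left (measurable_evariance_right hfm)]
  refine lintegral_mono_ae ?_
  filter_upwards [ae_memLp_two_prodMk hfm hf] with a ha
  -- For fixed `a`, the mean square about the global mean is the variance in `b` plus a squared
  -- bias. The bias is the `b`-mean of `f (a, b) - ∫ f (·, b)`, so Jensen bounds its square by a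
  -- term that integrates over `a` to the variances in the first variable.
  rw [lintegral_ofReal_sq_sub_const ha, hm, ← integral_sub (ha.integrable one_le_two) hh]
  gcongr
  exact ofReal_sq_integral_le ((ha.integrable one_le_two).sub hh)

open ProbabilityTheory in
theorem MeasureTheory.MeasurePreserving.evariance_comp {α β : Type*} [MeasurableSpace α]
    [MeasurableSpace β] {μ : Measure α} {ν : Measure β} {e : α ≃ᵐ β} (he : MeasurePreserving e μ ν)
    (f : β → ℝ) : evariance (fun a => f (e a)) μ = evariance f ν := by
  rw [evariance_eq_lintegral_ofReal, evariance_eq_lintegral_ofReal, he.integral_comp',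
    ← he.map_eq, lintegral_map_equiv]

open ProbabilityTheory in
/-- The Efron–Stein inequality. -/
theorem evariance_pi_le {α : Type*} [MeasurableSpace α] (μ : Measure α) [IsProbabilityMeasure μ]
    {n : ℕ} {f : (Fin n → α) → ℝ} (hfm : Measurable f) (hf : MemLp f 2 (Measure.pi fun _ => μ)) :
    evariance f (Measure.pi fun _ => μ) ≤
      ∑ i, ∫⁻ x, evariance (fun t => f (Function.update x i t)) μ ∂Measure.pi fun _ => μ := by
  induction n with
  | zero =>
    have : f = fun _ => f default := by funext x; rw [Subsingleton.elim x default]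
    rw [evariance_eq_lintegral_ofReal, this]
    simp
  | succ n ih =>
    have he := measurePreserving_piFinSuccAbove (fun _ : Fin (n + 1) => μ) 0
    set e := MeasurableEquiv.piFinSuccAbove (fun _ : Fin (n + 1) => α) 0
    have hsymm : ∀ (a : α) (y : Fin n → α), e.symm (a, y) = Fin.cons a y := by
      intro a y
      simp [e, MeasurableEquiv.piFinSuccAbove]
      rfl
    have hFm : Measurable fun p => f (e.symm p) := hfm.comp e.symm.measurable
    have hF : MemLp (fun p => f (e.symm p)) 2 (μ.prod (Measure.pi fun _ : Fin n => μ)) :=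
      hf.comp_measurePreserving he.symm
    have hmeas : ∀ i, Measurable fun x : Fin (n + 1) → α =>
        evariance (fun t => f (Function.update x i t)) μ := fun i =>
      measurable_evariance_right
        (G := fun p : (Fin (n + 1) → α) × α => f (Function.update p.1 i p.2))
        (hfm.comp measurable_update')
    have hfub : ∀ i, ∫⁻ x, evariance (fun t => f (Function.update x i t)) μ
          ∂(Measure.pi fun _ => μ) = ∫⁻ a, ∫⁻ y, evariance
            (fun t => f (Function.update (Fin.cons a y : Fin (n + 1) → α) i t)) μ
            ∂(Measure.pi fun _ => μ) ∂μ := by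
      intro i
      rw [← he.symm.map_eq, lintegral_map_equiv, lintegral_prod]
      · simp_rw [hsymm]
      · exact ((hmeas i).comp e.symm.measurable).aemeasurable
    rw [← he.symm.evariance_comp]
    refine (evariance_prod_le μ _ hFm hF).trans ?_
    simp_rw [Fin.sum_univ_succ, hfub, ← Fin.cons_update, Fin.update_cons_zero, hsymm]
    rw [add_comm]
    gcongr
    · simp
    · rw [← lintegral_finsetSum]
      · refine lintegral_mono_ae ?_
        -- The induction hypothesis applies to almost every section in the remaining coordinates.
        filter_upwards [ae_memLp_two_prodMk hFm hF] with a ha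
        simp_rw [hsymm] at ha
        refine ih ?_ ha
        simp_rw [← hsymm]
        exact hFm.comp measurable_prodMk_left
      · intro i _
        have h := (hmeas i.succ).comp e.symm.measurable
        have h2 := Measurable.lintegral_prod_right' (ν := Measure.pi fun _ : Fin n => μ) h
        simpa only [Function.comp_apply, hsymm, ← Fin.cons_update] using h2

/-- Resampling one coordinate independently does not change a product law. -/
theorem lintegral_lintegral_update {ι α : Type*} [Fintype ι] [DecidableEq ι] [MeasurableSpace α]
    (μ : Measure α) [IsProbabilityMeasure μ] {g : (ι → α) → ℝ≥0∞} (hg : Measurable g) (i : ι) :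
    ∫⁻ x, ∫⁻ t, g (Function.update x i t) ∂μ ∂(Measure.pi fun _ => μ) =
      ∫⁻ x, g x ∂Measure.pi fun _ => μ := by
  refine lintegral_eq_of_lmarginal_eq {i} ?_ hg ?_
  · exact Measurable.lintegral_prod_right'
      (f := fun p : (ι → α) × α => g (Function.update p.1 i p.2)) (hg.comp measurable_update')
  · rw [lmarginal_singleton, lmarginal_singleton]
    simp

/-! ### Product structure and the inequality in dimension `n` -/

theorem exp_neg_sum_div (r : ℝ) {n : ℕ} (x : Fin n → ℝ) :
    Real.exp (-(∑ i, |x i| ^ r) / r) = ∏ i, Real.exp (-|x i| ^ r / r) := by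
  rw [← Real.exp_sum, ← Finset.sum_div, Finset.sum_neg_distrib]

theorem tilted_eq_pi_muR {r : ℝ} (hr : 0 < r) (n : ℕ) :
    (volume : Measure (Fin n → ℝ)).tilted (fun x => -(∑ i, |x i| ^ r) / r) =
      Measure.pi fun _ => muR r := by
  have := isProbabilityMeasure_muR hr
  symm
  refine Measure.pi_eq fun s hs => ?_
  simp_rw [muR, tilted_apply_eq_ofReal_integral, exp_neg_sum_div]
  rw [integral_fintype_prod_volume_eq_prod (fun (_ : Fin n) (x : ℝ) => Real.exp (-|x| ^ r / r)),
    integral_div, volume_pi, Measure.restrict_pi_pi,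
    integral_fintype_prod_eq_prod (fun (_ : Fin n) (x : ℝ) => Real.exp (-|x| ^ r / r)),
    ← Finset.prod_div_distrib, ENNReal.ofReal_prod_of_nonneg]
  · simp_rw [integral_div]
  · intro i _
    exact div_nonneg (integral_nonneg fun x => (Real.exp_pos _).le)
      (integral_nonneg fun x => (Real.exp_pos _).le)

theorem measurePreserving_toLp_muRN {r : ℝ} (hr : 0 < r) (n : ℕ) :
    MeasurePreserving (MeasurableEquiv.toLp 2 (Fin n → ℝ)) (Measure.pi fun _ => muR r)
      (muRN r n) := by
  have hp : MeasurePreserving (MeasurableEquiv.toLp 2 (Fin n → ℝ)) volume volume :=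
    PiLp.volume_preserving_toLp (Fin n)
  refine ⟨(MeasurableEquiv.toLp 2 (Fin n → ℝ)).measurable, ?_⟩
  ext s hs
  rw [MeasurableEquiv.map_apply, ← tilted_eq_pi_muR hr, muRN,
    tilted_apply' _ _ hs, tilted_apply' _ _ ((MeasurableEquiv.measurable _) hs),
    ← hp.setLIntegral_comp_preimage_emb (MeasurableEquiv.measurableEmbedding _),
    ← hp.integral_comp']
  rfl

theorem deriv_comp_toLp_update {n : ℕ} {f : EuclideanSpace ℝ (Fin n) → ℝ}
    (hf : Differentiable ℝ f) (x : Fin n → ℝ) (i : Fin n) (t : ℝ) :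
    deriv (fun t => f (WithLp.toLp 2 (Function.update x i t))) t =
      partialDeriv f i (WithLp.toLp 2 (Function.update x i t)) := by
  have h1 : HasDerivAt (Function.update x i) (Pi.single i 1) t := hasDerivAt_update x i t
  have h2 := ((PiLp.continuousLinearEquiv 2 ℝ (fun _ : Fin n => ℝ)).symm.hasFDerivAt
    (x := Function.update x i t)).comp_hasDerivAt t h1
  have h3 := (hf (WithLp.toLp 2 (Function.update x i t))).hasFDerivAt.comp_hasDerivAt t h2
  exact h3.deriv

theorem measurable_partialDeriv {n : ℕ} {f : EuclideanSpace ℝ (Fin n) → ℝ}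
    (hf : ContDiff ℝ 1 f) (i : Fin n) : Measurable (partialDeriv f i) := by
  have h : Continuous (fderiv ℝ f) := hf.continuous_fderiv one_ne_zero
  have : Continuous (partialDeriv f i) := by unfold partialDeriv; fun_prop
  exact this.measurable

/-- Efron–Stein reduces the variance to sections along coordinate lines, each controlled by
`evariance_muR_le`; the resampled coordinate is then absorbed by `lintegral_lintegral_update`. -/
theorem evariance_muRN_le {r : ℝ} (hr : 1 ≤ r) {n : ℕ} {f : EuclideanSpace ℝ (Fin n) → ℝ}
    (hf : ContDiff ℝ 1 f) (hL : MemLp f 2 (muRN r n)) :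
    ProbabilityTheory.evariance f (muRN r n) ≤ 4 * ∫⁻ x, ENNReal.ofReal (∑ i : Fin n,
      |x i| ^ (2 - r) / (|x i| ^ r + 2 * (r - 1)) * partialDeriv f i x ^ 2) ∂muRN r n := by
  have hr0 : 0 < r := by linarith
  have := isProbabilityMeasure_muR hr0
  have he := measurePreserving_toLp_muRN hr0 n
  have hpm := measurable_partialDeriv hf
  have hw : ∀ y : ℝ, 0 ≤ |y| ^ (2 - r) / (|y| ^ r + 2 * (r - 1)) := by
    intro y
    have : 0 ≤ r - 1 := by linarith
    positivity
  set g : Fin n → EuclideanSpace ℝ (Fin n) → ℝ≥0∞ := fun i x => ENNReal.ofReal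
    (4 * (|x i| ^ (2 - r) / (|x i| ^ r + 2 * (r - 1)) * partialDeriv f i x ^ 2)) with hg
  have hgm : ∀ i, Measurable (g i) := by
    intro i
    have := hpm i
    fun_prop
  have hrhs : 4 * ∫⁻ x, ENNReal.ofReal (∑ i : Fin n,
      |x i| ^ (2 - r) / (|x i| ^ r + 2 * (r - 1)) * partialDeriv f i x ^ 2) ∂muRN r n =
      ∑ i, ∫⁻ x, g i x ∂muRN r n := by
    rw [← lintegral_finsetSum _ fun i _ => hgm i, ← lintegral_const_mul' _ _ ENNReal.ofNat_ne_top]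
    refine lintegral_congr fun x => ?_
    rw [show (4 : ℝ≥0∞) = ENNReal.ofReal 4 by norm_num, ← ENNReal.ofReal_mul (by norm_num),
      Finset.mul_sum, ENNReal.ofReal_sum_of_nonneg]
    intro i _
    have := hw (x i)
    positivity
  rw [hrhs, ← he.evariance_comp]
  refine (evariance_pi_le (muR r) (hf.continuous.measurable.comp he.measurable)
    (hL.comp_measurePreserving he)).trans ?_
  refine Finset.sum_le_sum fun i _ => ?_
  have hres := lintegral_lintegral_update (muR r) ((hgm i).comp he.measurable) i
  simp only [Function.comp_apply] at hres
  rw [← he.lintegral_comp (hgm i), ← hres]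
  refine lintegral_mono fun x => ?_
  have hc : ContDiff ℝ 1 fun t => f (WithLp.toLp 2 (Function.update x i t)) :=
    hf.comp ((PiLp.continuousLinearEquiv 2 ℝ (fun _ : Fin n => ℝ)).symm.contDiff.comp
      (contDiff_update 1 x i))
  refine (evariance_muR_le hr hc).trans (le_of_eq ?_)
  refine lintegral_congr fun t => ?_
  rw [deriv_comp_toLp_update (hf.differentiable one_ne_zero)]
  simp [hg]

theorem norm_gradient_sq {n : ℕ} {f : EuclideanSpace ℝ (Fin n) → ℝ} (x : EuclideanSpace ℝ (Fin n)) :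
    ‖∇ f x‖ ^ 2 = ∑ i, partialDeriv f i x ^ 2 := by
  rw [EuclideanSpace.norm_sq_eq]
  refine Finset.sum_congr rfl fun i _ => ?_
  rw [Real.norm_eq_abs, sq_abs, partialDeriv, ← inner_gradient_left,
    EuclideanSpace.inner_single_right]
  simp

theorem proposition11 (r : ℝ) (hr : r ∈ Set.Icc (1 : ℝ) 2) :
    constC r ∈ Set.Ioc (9 / 5 : ℝ) 4 ∧
    ∀ (n : ℕ) (f : EuclideanSpace ℝ (Fin n) → ℝ),
      ContDiff ℝ ∞ f → MemLp f 2 (muRN r n) →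
      ENNReal.ofReal (∫ x, f x ^ 2 ∂(muRN r n) - (∫ x, f x ∂(muRN r n)) ^ 2) ≤
          4 * ∫⁻ x, ENNReal.ofReal (∑ i : Fin n,
            |x i| ^ (2 - r) / (|x i| ^ r + 2 * (r - 1)) * partialDeriv f i x ^ 2) ∂(muRN r n) ∧
      4 * ∫⁻ x, ENNReal.ofReal (∑ i : Fin n,
            |x i| ^ (2 - r) / (|x i| ^ r + 2 * (r - 1)) * partialDeriv f i x ^ 2) ∂(muRN r n) ≤
          ENNReal.ofReal (constC r) * ∫⁻ x, ENNReal.ofReal (‖∇ f x‖ ^ 2) ∂(muRN r n) := by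
  refine ⟨⟨nine_fifths_lt_constC hr, constC_le_four hr⟩, fun n f hf hL => ⟨?_, ?_⟩⟩
  · have hr0 : 0 < r := lt_of_lt_of_le one_pos hr.1
    have := isProbabilityMeasure_muR hr0
    have he := measurePreserving_toLp_muRN hr0 n
    have : IsProbabilityMeasure (muRN r n) := by
      rw [← he.map_eq]
      exact Measure.isProbabilityMeasure_map he.measurable.aemeasurable
    have h := evariance_muRN_le hr.1 (hf.of_le (by simp)) hL
    rw [← ProbabilityTheory.ofReal_variance hL, ProbabilityTheory.variance_eq_sub hL] at h
    simpa only [Pi.pow_apply] using h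
  · rw [← lintegral_const_mul' _ _ ENNReal.ofNat_ne_top,
      ← lintegral_const_mul' _ _ ENNReal.ofReal_ne_top]
    refine lintegral_mono fun x => ?_
    have hC : 0 ≤ constC r := le_trans (by norm_num) (nine_fifths_lt_constC hr).le
    rw [show (4 : ℝ≥0∞) = ENNReal.ofReal 4 by norm_num, ← ENNReal.ofReal_mul (by norm_num),
      ← ENNReal.ofReal_mul hC, norm_gradient_sq, Finset.mul_sum, Finset.mul_sum]
    refine ENNReal.ofReal_le_ofReal (Finset.sum_le_sum fun i _ => ?_)
    rw [← mul_assoc]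
    exact mul_le_mul_of_nonneg_right (four_mul_weight_le_constC hr (x i)) (sq_nonneg _)
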